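/- Let $l>0$, $\alpha,\theta\in\mathbb{R}$, $\beta\in\mathbb{R}\setminus\{0\}$, and let $V\in L^2[0,l]$ be real-valued. Let $D$ be the Dirichlet operator in $L^2[0,l]$, \[ Df=-f''+Vf,\qquad \operatorname{dom}D=\{f\in H^2[0,l]: f(0)=f(l)=0\}. \] Let $\mathcal H=\bigoplus_{(m,n)\in\mathbb{Z}^2}\big(L^2[0,l]\oplus L^2[0,l]\big)$, with elements $\phi=(\phi_{m,n,r},\phi_{m,n,u})_{(m,n)\in\mathbb{Z}^2}$, and let $\Lambda$ be the operator in $\mathcal H$ that acts on each component as $\phi_{m,n,r/u}\mapsto-\phi''_{m,n,r/u}+V\phi_{m,n,r/u}$, whose domain consists of all $\phi\in\mathcal H$ such that $\phi_{m,n,r},\phi_{m,n,u}\in H^2[0,l]$ for all $m,n$, the family $(-\phi''_{m,n,r/u}+V\phi_{m,n,r/u})$ belongs to $\mathcal H$, and for all $m,n\in\mathbb{Z}$ \[ \phi_{m,n}:=\phi_{m,n,r}(0)=\tfrac1\beta\,\phi_{m,n,u}(0)=e^{-i\pi n\theta}\phi_{m-1,n,r}(l)=\tfrac1\beta\,e^{i\pi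 m\theta}\phi_{m,n-1,u}(l), \] \[ \phi'_{m,n,r}(0)+\beta\phi'_{m,n,u}(0)-e^{-i\pi n\theta}\phi'_{m-1,n,r}(l)-\beta e^{i\pi m\theta}\phi'_{m,n-1,u}(l)=\alpha\,\phi_{m,n}. \] Then $\operatorname{spec}D\subset\operatorname{spec}\Lambda$. Moreover, each $\mu\in\operatorname{spec}D$ is an infinitely degenerate eigenvalue of $\Lambda$, that is, the space $\{\phi\in\operatorname{dom}\Lambda:\Lambda\phi=\mu\phi\}$ is infinite-dimensional. -/

import Mathlib

open MeasureTheory Set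

namespace MagneticLattice

noncomputable section

/-! ### Unbounded operators: spectrum and eigenvalues -/

section Unbounded

variable {E : Type*} [NormedAddCommGroup E] [NormedSpace ℂ E]

/-- `z` lies in the resolvent set of the unbounded operator `T` when `T - z : dom T → E` has a
bounded inverse defined on all of `E`. -/
def resolventSet (T : E →ₗ.[ℂ] E) : Set ℂ :=
  {z | ∃ R : E →L[ℂ] E,
    (∀ y : E, ∃ h : R y ∈ T.domain, T ⟨R y, h⟩ - z • R y = y) ∧
    (∀ x : T.domain, R (T x - z • (x : E)) = x)}

/-- The spectrum of an unbounded operator. -/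
def spec (T : E →ₗ.[ℂ] E) : Set ℂ := (resolventSet T)ᶜ

/-- The space of all `x ∈ dom T` with `T x = z x`. -/
def eigenspace (T : E →ₗ.[ℂ] E) (z : ℂ) : Submodule ℂ E :=
  (LinearMap.ker (T.toFun - z • T.domain.subtype)).map T.domain.subtype

/-- `z` is an eigenvalue of `T`. -/
def IsEigenvalue (T : E →ₗ.[ℂ] E) (z : ℂ) : Prop := eigenspace T z ≠ ⊥

/-- `z` is an eigenvalue of `T` whose eigenspace has infinite dimension. -/
def IsInfinitelyDegenerateEigenvalue (T : E →ₗ.[ℂ] E) (z : ℂ) : Prop :=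
  IsEigenvalue T z ∧ ¬ FiniteDimensional ℂ (eigenspace T z)

end Unbounded

/-! ### A single edge -/

/-- Lebesgue measure on `[0, l]`. -/
abbrev edgeMeasure (l : ℝ) : Measure ℝ := volume.restrict (Icc 0 l)

/-- The Hilbert space `L²[0, l]`. -/
abbrev EdgeL2 (l : ℝ) : Type := Lp ℂ 2 (edgeMeasure l)

/-- `f` belongs to the Sobolev space `H²[0, l]`, with first derivative `f'` and second
derivative `f''`: `f` is differentiable on `[0, l]` with derivative `f'`, the function `f'` is
absolutely continuous, and its almost everywhere derivative `f''` is square integrable. -/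
structure IsH2 (l : ℝ) (f f' f'' : ℝ → ℂ) : Prop where
  hasDeriv : ∀ t ∈ Icc 0 l, HasDerivWithinAt f (f' t) (Icc 0 l) t
  absCont : AbsolutelyContinuousOnInterval f' 0 l
  hasDeriv_ae : ∀ᵐ t ∂(edgeMeasure l), HasDerivAt f' (f'' t) t
  memLp : MemLp f'' 2 (edgeMeasure l)

/-- The class `u ∈ L²[0, l]` lies in `H²[0, l]`, its `C¹` representative is `f`, with
derivative `f'`, and `v = - u'' + V u`. -/
def EdgeAction (l : ℝ) (V : ℝ → ℝ) (u v : EdgeL2 l) (f f' : ℝ → ℂ) : Prop :=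
  ∃ f'' : ℝ → ℂ, IsH2 l f f' f'' ∧ u =ᵐ[edgeMeasure l] f ∧
    v =ᵐ[edgeMeasure l] fun t => - f'' t + (V t : ℂ) * f t

theorem EdgeAction.zero (l : ℝ) (V : ℝ → ℝ) : EdgeAction l V 0 0 0 0 := by
  refine ⟨0, ⟨fun t _ => ?_, ?_, ?_, MemLp.zero⟩, Lp.coeFn_zero _ _ _, ?_⟩
  · exact hasDerivWithinAt_const t _ (0 : ℂ)
  · have h : LipschitzOnWith 0 (0 : ℝ → ℂ) (uIcc 0 l) :=
      (LipschitzWith.const (0 : ℂ)).lipschitzOnWith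
    exact h.absolutelyContinuousOnInterval
  · exact Filter.Eventually.of_forall fun t => hasDerivAt_const t (0 : ℂ)
  · filter_upwards [Lp.coeFn_zero ℂ 2 (edgeMeasure l)] with t ht
    rw [ht]
    simp

theorem EdgeAction.add {l : ℝ} {V : ℝ → ℝ} {u v u₁ v₁ : EdgeL2 l} {f f' g g' : ℝ → ℂ}
    (h : EdgeAction l V u v f f') (h₁ : EdgeAction l V u₁ v₁ g g') :
    EdgeAction l V (u + u₁) (v + v₁) (f + g) (f' + g') := by
  obtain ⟨f'', H, hu, hv⟩ := h
  obtain ⟨g'', H₁, hu₁, hv₁⟩ := h₁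
  refine ⟨f'' + g'', ⟨fun t ht => (H.hasDeriv t ht).add (H₁.hasDeriv t ht),
    H.absCont.add H₁.absCont, ?_, H.memLp.add H₁.memLp⟩, ?_, ?_⟩
  · filter_upwards [H.hasDeriv_ae, H₁.hasDeriv_ae] with t a b using a.add b
  · filter_upwards [Lp.coeFn_add u u₁, hu, hu₁] with t a b c
    rw [a, Pi.add_apply, b, c, Pi.add_apply]
  · filter_upwards [Lp.coeFn_add v v₁, hv, hv₁] with t a b c
    simp only [a, b, c, Pi.add_apply]
    ring

theorem EdgeAction.smul {l : ℝ} {V : ℝ → ℝ} {u v : EdgeL2 l} {f f' : ℝ → ℂ} (c : ℂ)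
    (h : EdgeAction l V u v f f') : EdgeAction l V (c • u) (c • v) (c • f) (c • f') := by
  obtain ⟨f'', H, hu, hv⟩ := h
  refine ⟨c • f'', ⟨fun t ht => (H.hasDeriv t ht).const_smul c,
    H.absCont.const_smul c, ?_, H.memLp.const_smul c⟩, ?_, ?_⟩
  · filter_upwards [H.hasDeriv_ae] with t a using a.const_smul c
  · filter_upwards [Lp.coeFn_smul c u, hu] with t a b
    simp [a, b]
  · filter_upwards [Lp.coeFn_smul c v, hv] with t a b
    simp only [a, b, Pi.smul_apply, smul_eq_mul]
    ring

theorem EdgeAction.eq_zero {l : ℝ} (hl : 0 < l) {V : ℝ → ℝ} {v : EdgeL2 l} {f f' : ℝ → ℂ}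
    (h : EdgeAction l V 0 v f f') : v = 0 := by
  obtain ⟨f'', H, hu, hv⟩ := h
  have hcont : ContinuousOn f (Icc 0 l) := fun t ht => (H.hasDeriv t ht).continuousWithinAt
  have hf0 : ∀ t ∈ Icc 0 l, f t = 0 := by
    have hae : f =ᵐ[edgeMeasure l] fun _ => (0 : ℂ) :=
      hu.symm.trans (Lp.coeFn_zero ℂ 2 (edgeMeasure l))
    have := Measure.eqOn_Icc_of_ae_eq volume hl.ne hae hcont continuousOn_const
    exact fun t ht => this ht
  have hf'0 : ∀ t ∈ Icc 0 l, f' t = 0 := fun t ht =>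
    (uniqueDiffOn_Icc hl t ht).eq_deriv _ (H.hasDeriv t ht)
      ((hasDerivWithinAt_const t _ (0 : ℂ)).congr hf0 (hf0 t ht))
  have hIoo : ∀ᵐ t ∂(edgeMeasure l), t ∈ Ioo 0 l := by
    have : edgeMeasure l = volume.restrict (Ioo 0 l) := (restrict_Ioo_eq_restrict_Icc).symm
    rw [this]
    exact ae_restrict_mem measurableSet_Ioo
  apply Lp.ext
  filter_upwards [Lp.coeFn_zero ℂ 2 (edgeMeasure l), hv, H.hasDeriv_ae, hIoo] with t h0 h1 h2 h3
  have h4 : HasDerivAt f' 0 t := (hasDerivAt_const t (0 : ℂ)).congr_of_eventuallyEq <| by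
    filter_upwards [Ioo_mem_nhds h3.1 h3.2] with s hs using hf'0 s (Ioo_subset_Icc_self hs)
  rw [h0, h1, h2.unique h4, hf0 t (Ioo_subset_Icc_self h3)]
  simp

/-- The graph of the Dirichlet operator `D`. -/
def dirichletGraph (l : ℝ) (V : ℝ → ℝ) : Submodule ℂ (EdgeL2 l × EdgeL2 l) where
  carrier := {p | ∃ f f' : ℝ → ℂ, EdgeAction l V p.1 p.2 f f' ∧ f 0 = 0 ∧ f l = 0}
  zero_mem' := ⟨0, 0, EdgeAction.zero l V, rfl, rfl⟩
  add_mem' := by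
    rintro p q ⟨f, f', h, h0, hl⟩ ⟨g, g', k, k0, kl⟩
    exact ⟨f + g, f' + g', h.add k, by simp [h0, k0], by simp [hl, kl]⟩
  smul_mem' := by
    rintro c p ⟨f, f', h, h0, hl⟩
    exact ⟨c • f, c • f', h.smul c, by simp [h0], by simp [hl]⟩

/-- The Dirichlet operator `D f = - f'' + V f` on `L²[0, l]`, with domain
`{f ∈ H²[0, l] | f 0 = f l = 0}`. -/
def dirichletOp (l : ℝ) (V : ℝ → ℝ) : EdgeL2 l →ₗ.[ℂ] EdgeL2 l :=
  (dirichletGraph l V).toLinearPMap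

theorem dirichletOp_graph {l : ℝ} (hl : 0 < l) (V : ℝ → ℝ) :
    (dirichletOp l V).graph = dirichletGraph l V := by
  refine Submodule.toLinearPMap_graph_eq _ ?_
  rintro ⟨u, v⟩ ⟨f, f', h, -, -⟩ hu
  obtain rfl : u = 0 := hu
  exact h.eq_zero hl

/-! ### The square lattice -/

/-- The two kinds of edges issuing from a node. -/
inductive Dir
  | right
  | up

/-- The edge `(m, n, right)` joins the node `(m, n)`, identified with `0 ∈ [0, l]`, to
`(m + 1, n)`, identified with `l`; the edge `(m, n, up)` joins `(m, n)` to `(m, n + 1)`. -/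
abbrev Edge : Type := ℤ × ℤ × Dir

/-- The phase space of the lattice: the Hilbert sum of `L²[0, l]` over all edges. -/
abbrev LatticeL2 (l : ℝ) : Type := lp (fun _ : Edge => EdgeL2 l) 2

/-- The phase `exp (i π x)`. -/
def phase (x : ℝ) : ℂ := Complex.exp (Complex.I * Real.pi * x)

/-- The boundary conditions at all nodes for a family `f` of functions on the edges with
derivatives `f'`. The value at the node `(m, n)` is `f (m, n, right) 0`. -/
structure NodeConditions (l θ α β : ℝ) (f f' : Edge → ℝ → ℂ) : Prop where
  value_up_start : ∀ m n : ℤ,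
    f (m, n, .right) 0 = 1 / (β : ℂ) * f (m, n, .up) 0
  value_right_end : ∀ m n : ℤ,
    f (m, n, .right) 0 = phase (-(n * θ)) * f (m - 1, n, .right) l
  value_up_end : ∀ m n : ℤ,
    f (m, n, .right) 0 = 1 / (β : ℂ) * phase (m * θ) * f (m, n - 1, .up) l
  flux : ∀ m n : ℤ,
    f' (m, n, .right) 0 + (β : ℂ) * f' (m, n, .up) 0
      - phase (-(n * θ)) * f' (m - 1, n, .right) l
      - (β : ℂ) * phase (m * θ) * f' (m, n - 1, .up) l
      = (α : ℂ) * f (m, n, .right) 0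

/-- The graph of the lattice Hamiltonian `Λ`. -/
def latticeGraph (l : ℝ) (V : ℝ → ℝ) (θ α β : ℝ) :
    Submodule ℂ (LatticeL2 l × LatticeL2 l) where
  carrier := {p | ∃ f f' : Edge → ℝ → ℂ,
    (∀ e, EdgeAction l V (p.1 e) (p.2 e) (f e) (f' e)) ∧ NodeConditions l θ α β f f'}
  zero_mem' := ⟨0, 0, fun _ => EdgeAction.zero l V, by constructor <;> simp⟩
  add_mem' := by
    rintro p q ⟨f, f', h, hb⟩ ⟨g, g', k, kb⟩
    refine ⟨f + g, f' + g', fun e => (h e).add (k e), ?_, ?_, ?_, ?_⟩ <;> intro m n <;>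
      simp only [Pi.add_apply]
    · linear_combination hb.value_up_start m n + kb.value_up_start m n
    · linear_combination hb.value_right_end m n + kb.value_right_end m n
    · linear_combination hb.value_up_end m n + kb.value_up_end m n
    · linear_combination hb.flux m n + kb.flux m n
  smul_mem' := by
    rintro c p ⟨f, f', h, hb⟩
    refine ⟨c • f, c • f', fun e => (h e).smul c, ?_, ?_, ?_, ?_⟩ <;> intro m n <;>
      simp only [Pi.smul_apply, smul_eq_mul]
    · linear_combination c * hb.value_up_start m n
    · linear_combination c * hb.value_right_end m n
    · linear_combination c * hb.value_up_end m n
    · linear_combination c * hb.flux m n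

/-- The lattice Hamiltonian `Λ`: it acts as `φ ↦ - φ'' + V φ` on every edge; its domain
consists of all `φ` in the phase space that are in `H²[0, l]` on every edge, satisfy the node
conditions, and for which `- φ'' + V φ` is again in the phase space. -/
def latticeOp (l : ℝ) (V : ℝ → ℝ) (θ α β : ℝ) : LatticeL2 l →ₗ.[ℂ] LatticeL2 l :=
  (latticeGraph l V θ α β).toLinearPMap

theorem latticeOp_graph {l : ℝ} (hl : 0 < l) (V : ℝ → ℝ) (θ α β : ℝ) :
    (latticeOp l V θ α β).graph = latticeGraph l V θ α β := by
  refine Submodule.toLinearPMap_graph_eq _ ?_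
  rintro ⟨u, v⟩ ⟨f, f', h, -⟩ hu
  obtain rfl : u = 0 := hu
  refine lp.ext (funext fun e => ?_)
  exact (h e).eq_zero hl

end

end MagneticLattice

open MeasureTheory Set

namespace MagneticLattice

noncomputable section

open scoped BoundedContinuousFunction

/-! ### The Green operator of the free Dirichlet problem -/

/-! A point of the Dirichlet spectrum is an eigenvalue, and its eigenfunction vanishes at both ends
of an edge, so copies of it can be placed on finitely many edges to give eigenfunctions of the
lattice operator.

Eigenvalue (`exists_dirichlet_eigenvector`): let `G` solve `- f'' = h` with Dirichlet data. Then `(D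
- z) u = y` becomes `u - K u = G y` with `K = G (z - V)`. Since `V` is only in `L²`, `(z - V) u` is
only in `L¹`, so `G` must be compact from `L¹` (`isCompactOperator_greenOp`). By the Fredholm
alternative, either `K` fixes a nonzero `u`, an eigenvector of `D`, or `(1 - K)⁻¹ G` is the
resolvent of `D` at `z`.

Degeneracy (`exists_submodule_le_ker_nodeFlux`): with a multiple `c e` of the eigenfunction on each
edge, all node values vanish and only one linear flux equation per node remains. The edges issuing
from a `k × 2` block number `4 k` and touch `3 (k + 1)` nodes, which leaves at least `k - 3`
independent solutions. A block of width one would not do: `2 k` edges, `2 (k + 1)` nodes. -/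

/-- The primitive of an integrable function is absolutely continuous. -/
theorem absolutelyContinuousOnInterval_integral {φ : ℝ → ℂ} (hφ : Integrable φ) (a b : ℝ) :
    AbsolutelyContinuousOnInterval (fun t => ∫ s in a..t, φ s) a b := by
  -- The real-valued statement is applied to the real and imaginary parts separately.
  have ofReal : ∀ {g : ℝ → ℝ}, AbsolutelyContinuousOnInterval g a b →
      AbsolutelyContinuousOnInterval (fun t => (g t : ℂ)) a b := by
    intro g hg
    rw [absolutelyContinuousOnInterval_iff] at hg ⊢
    simpa only [Complex.dist_eq, ← Complex.ofReal_sub, Complex.norm_real,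
      Real.dist_eq, Real.norm_eq_abs] using hg
  have hre := ofReal (hφ.re.intervalIntegrable (a := a) (b := b)
    |>.absolutelyContinuousOnInterval_intervalIntegral (c := a) (by simp))
  have him := ofReal (hφ.im.intervalIntegrable (a := a) (b := b)
    |>.absolutelyContinuousOnInterval_intervalIntegral (c := a) (by simp))
  have h := hre.add (him.const_smul Complex.I)
  have heq : (fun t => ∫ s in a..t, φ s) =
      (fun t => ((∫ v in a..t, RCLike.re (φ v) : ℝ) : ℂ)) +
        Complex.I • fun t => ((∫ v in a..t, RCLike.im (φ v) : ℝ) : ℂ) := by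
    funext t
    have hi : ∫ s in a..t, φ s =
        ∫ s in a..t, (((RCLike.re (φ s) : ℝ) : ℂ) + Complex.I * ((RCLike.im (φ s) : ℝ) : ℂ)) := by
      congr 1
      funext s
      rw [mul_comm]
      exact (Complex.re_add_im _).symm
    rw [hi, intervalIntegral.integral_add hφ.re.ofReal.intervalIntegrable
      (hφ.im.ofReal.intervalIntegrable.const_mul _), intervalIntegral.integral_const_mul]
    simp only [Pi.add_apply, Pi.smul_apply, smul_eq_mul]
    congr 1
    · exact intervalIntegral.integral_ofReal
    · congr 1
      exact intervalIntegral.integral_ofReal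
  rw [heq]
  exact h

/-- The solution `f` of `- f'' = φ`, `f 0 = f l = 0`. -/
def green (l : ℝ) (φ : ℝ → ℂ) (t : ℝ) : ℂ :=
  (t / l : ℝ) * (∫ r in 0..l, ∫ s in 0..r, φ s) - ∫ r in 0..t, ∫ s in 0..r, φ s

/-- The derivative of `green l φ`. -/
def greenDeriv (l : ℝ) (φ : ℝ → ℂ) (t : ℝ) : ℂ :=
  (1 / l : ℝ) * (∫ r in 0..l, ∫ s in 0..r, φ s) - ∫ s in 0..t, φ s

theorem green_zero (l : ℝ) (φ : ℝ → ℂ) : green l φ 0 = 0 := by simp [green]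

theorem green_self {l : ℝ} (hl : 0 < l) (φ : ℝ → ℂ) : green l φ l = 0 := by
  simp [green, hl.ne']

theorem green_congr (l : ℝ) {φ ψ : ℝ → ℂ} (h : φ =ᵐ[volume] ψ) : green l φ = green l ψ := by
  have : ∀ r : ℝ, ∫ s in 0..r, φ s = ∫ s in 0..r, ψ s := fun r =>
    intervalIntegral.integral_congr_ae (h.mono fun s hs _ => hs)
  funext t
  simp [green, this]

theorem continuous_integral {φ : ℝ → ℂ} (hφ : Integrable φ) :
    Continuous fun r => ∫ s in (0 : ℝ)..r, φ s :=
  intervalIntegral.continuous_primitive (fun _ _ => hφ.intervalIntegrable) 0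

theorem green_add (l : ℝ) {φ ψ : ℝ → ℂ} (hφ : Integrable φ) (hψ : Integrable ψ) (t : ℝ) :
    green l (φ + ψ) t = green l φ t + green l ψ t := by
  have h1 : ∀ r : ℝ, ∫ s in 0..r, (φ + ψ) s = (∫ s in 0..r, φ s) + ∫ s in 0..r, ψ s := fun r =>
    intervalIntegral.integral_add hφ.intervalIntegrable hψ.intervalIntegrable
  have h2 : ∀ r : ℝ, ∫ x in 0..r, ((∫ s in 0..x, φ s) + ∫ s in 0..x, ψ s) =
      (∫ x in 0..r, ∫ s in 0..x, φ s) + ∫ x in 0..r, ∫ s in 0..x, ψ s := fun r =>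
    intervalIntegral.integral_add ((continuous_integral hφ).intervalIntegrable _ _)
      ((continuous_integral hψ).intervalIntegrable _ _)
  simp only [green, h1, h2]
  ring

theorem green_smul (l : ℝ) (c : ℂ) (φ : ℝ → ℂ) (t : ℝ) :
    green l (c • φ) t = c * green l φ t := by
  simp only [green, Pi.smul_apply, smul_eq_mul, intervalIntegral.integral_const_mul]
  ring

theorem hasDerivAt_green (l : ℝ) {φ : ℝ → ℂ} (hφ : Integrable φ) (t : ℝ) :
    HasDerivAt (green l φ) (greenDeriv l φ t) t := by
  have h1 : HasDerivAt (fun t : ℝ => ((t / l : ℝ) : ℂ)) ((1 / l : ℝ) : ℂ) t :=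
    ((hasDerivAt_id t).div_const l).ofReal_comp
  exact (h1.mul_const _).sub (((continuous_integral hφ).integral_hasStrictDerivAt 0 t).hasDerivAt)

theorem norm_integral_le {φ : ℝ → ℂ} (hφ : Integrable φ) (t : ℝ) :
    ‖∫ s in 0..t, φ s‖ ≤ ∫ s, ‖φ s‖ :=
  (intervalIntegral.norm_integral_le_integral_norm_uIoc).trans
    (setIntegral_le_integral hφ.norm (Filter.Eventually.of_forall fun _ => norm_nonneg _))

theorem norm_greenDeriv_le {l : ℝ} (hl : 0 < l) {φ : ℝ → ℂ} (hφ : Integrable φ) (t : ℝ) :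
    ‖greenDeriv l φ t‖ ≤ 2 * ∫ s, ‖φ s‖ := by
  have h1 : ‖∫ r in 0..l, ∫ s in 0..r, φ s‖ ≤ (∫ s, ‖φ s‖) * |l - 0| :=
    intervalIntegral.norm_integral_le_of_norm_le_const fun r _ => norm_integral_le hφ r
  have h2 : ‖((1 / l : ℝ) : ℂ) * ∫ r in 0..l, ∫ s in 0..r, φ s‖ ≤ ∫ s, ‖φ s‖ := by
    rw [norm_mul, Complex.norm_real, Real.norm_of_nonneg (by positivity)]
    rw [sub_zero, abs_of_pos hl] at h1
    rw [div_mul_eq_mul_div, one_mul, div_le_iff₀ hl]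
    exact h1
  calc _ ≤ _ := norm_sub_le _ _
    _ ≤ _ := by linarith [norm_integral_le hφ t]

/-- Mean value inequality. The Lipschitz constant depends on `φ` only through its `L¹` norm, which
yields both the sup bound and the equicontinuity. -/
theorem norm_green_sub_le {l : ℝ} (hl : 0 < l) {φ : ℝ → ℂ} (hφ : Integrable φ) (s t : ℝ) :
    ‖green l φ t - green l φ s‖ ≤ 2 * (∫ s, ‖φ s‖) * |t - s| :=
  convex_univ.norm_image_sub_le_of_norm_hasDerivWithin_le
    (fun x _ => (hasDerivAt_green l hφ x).hasDerivWithinAt)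
    (fun x _ => norm_greenDeriv_le hl hφ x) (mem_univ s) (mem_univ t)

theorem norm_green_le {l : ℝ} (hl : 0 < l) {φ : ℝ → ℂ} (hφ : Integrable φ) {t : ℝ}
    (ht : t ∈ Icc 0 l) : ‖green l φ t‖ ≤ 2 * l * ∫ s, ‖φ s‖ := by
  have h := norm_green_sub_le hl hφ 0 t
  rw [green_zero, sub_zero, sub_zero, abs_of_nonneg ht.1] at h
  have : 0 ≤ ∫ s, ‖φ s‖ := integral_nonneg fun _ => norm_nonneg _
  nlinarith [ht.2]

/-- `green l φ` lies in `H²[0, l]` and solves `- f'' = φ`. -/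
theorem isH2_green {l : ℝ} {φ f'' : ℝ → ℂ} (hφ : Integrable φ)
    (hf'' : f'' =ᵐ[edgeMeasure l] fun t => - φ t) (hL2 : MemLp f'' 2 (edgeMeasure l)) :
    IsH2 l (green l φ) (greenDeriv l φ) f'' where
  hasDeriv t _ := (hasDerivAt_green l hφ t).hasDerivWithinAt
  absCont := by
    have hc : AbsolutelyContinuousOnInterval
        (fun _ : ℝ => ((1 / l : ℝ) : ℂ) * (∫ r in 0..l, ∫ s in 0..r, φ s)) 0 l :=
      ((LipschitzWith.const _).lipschitzOnWith (s := uIcc 0 l)).absolutelyContinuousOnInterval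
    exact hc.sub (absolutelyContinuousOnInterval_integral hφ 0 l)
  hasDeriv_ae := by
    have h := ae_restrict_of_ae (s := Icc 0 l) (LocallyIntegrable.ae_hasDerivAt_integral
      hφ.locallyIntegrable)
    filter_upwards [h, hf''] with t ht h2
    rw [h2]
    exact (ht 0).const_sub _
  memLp := hL2

/-! ### Compactness of the Green operator on `L¹[0, l]` -/

theorem integrable_indicator_L1 {l : ℝ} (h : Lp ℂ 1 (edgeMeasure l)) :
    Integrable ((Icc 0 l).indicator h) :=
  (integrable_indicator_iff measurableSet_Icc).2 (L1.integrable_coeFn h)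

theorem integral_norm_indicator_L1 {l : ℝ} (h : Lp ℂ 1 (edgeMeasure l)) :
    ∫ s, ‖(Icc 0 l).indicator h s‖ = ‖h‖ := by
  rw [L1.norm_eq_integral_norm]
  simp only [norm_indicator_eq_indicator_norm]
  exact integral_indicator measurableSet_Icc

theorem continuous_green (l : ℝ) {φ : ℝ → ℂ} (hφ : Integrable φ) : Continuous (green l φ) :=
  continuous_iff_continuousAt.2 fun t => (hasDerivAt_green l hφ t).continuousAt

/-- The Green operator from `L¹[0, l]` to the continuous functions on `[0, l]`. -/
def greenOp (l : ℝ) (hl : 0 < l) : Lp ℂ 1 (edgeMeasure l) →L[ℂ] (Icc (0 : ℝ) l →ᵇ ℂ) :=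
  LinearMap.mkContinuous
    { toFun h := BoundedContinuousFunction.mkOfCompact
        ⟨fun t => green l ((Icc 0 l).indicator h) t,
          (continuous_green l (integrable_indicator_L1 h)).comp continuous_subtype_val⟩
      map_add' h k := by
        ext t
        have : (Icc 0 l).indicator (h + k : Lp ℂ 1 (edgeMeasure l)) =ᵐ[volume]
            (Icc 0 l).indicator h + (Icc 0 l).indicator k := by
          rw [← indicator_add']
          exact (ae_eq_restrict_iff_indicator_ae_eq measurableSet_Icc).1 (Lp.coeFn_add h k)
        simp only [BoundedContinuousFunction.mkOfCompact_apply, ContinuousMap.coe_mk,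
          BoundedContinuousFunction.add_apply, green_congr l this]
        exact green_add l (integrable_indicator_L1 h) (integrable_indicator_L1 k) t
      map_smul' c h := by
        ext t
        have : (Icc 0 l).indicator (c • h : Lp ℂ 1 (edgeMeasure l)) =ᵐ[volume]
            c • (Icc 0 l).indicator h := by
          rw [← show (Icc 0 l).indicator (c • ⇑h) = c • (Icc 0 l).indicator h from
            indicator_const_smul _ c _]
          exact (ae_eq_restrict_iff_indicator_ae_eq measurableSet_Icc).1 (Lp.coeFn_smul c h)
        simp only [BoundedContinuousFunction.mkOfCompact_apply, ContinuousMap.coe_mk,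
          BoundedContinuousFunction.smul_apply, green_congr l this, smul_eq_mul, RingHom.id_apply]
        exact green_smul l c _ t }
    (2 * l) fun h => by
      refine (BoundedContinuousFunction.norm_le (by positivity)).2 fun t => ?_
      have := norm_green_le hl (integrable_indicator_L1 h) t.2
      rwa [integral_norm_indicator_L1] at this

theorem greenOp_apply {l : ℝ} (hl : 0 < l) (h : Lp ℂ 1 (edgeMeasure l)) (t : Icc (0 : ℝ) l) :
    greenOp l hl h t = green l ((Icc 0 l).indicator h) t := rfl

/-- Arzelà–Ascoli: the image of the unit ball is uniformly bounded and uniformly Lipschitz with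
constant 2. -/
theorem isCompactOperator_greenOp {l : ℝ} (hl : 0 < l) : IsCompactOperator (greenOp l hl) := by
  refine (isCompactOperator_iff_isCompact_closure_image_closedBall
    (greenOp l hl).toLinearMap one_pos).2 ?_
  refine BoundedContinuousFunction.arzela_ascoli (Metric.closedBall (0 : ℂ) ‖greenOp l hl‖)
    (isCompact_closedBall _ _) _ ?_ ?_
  · rintro _ t ⟨h, hh, rfl⟩
    rw [mem_closedBall_zero_iff] at hh ⊢
    exact (BoundedContinuousFunction.norm_coe_le_norm _ t).trans
      ((greenOp l hl).unit_le_opNorm h hh)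
  · refine Metric.equicontinuous_of_continuity_modulus (fun x => 2 * x) ?_ _ ?_
    · simpa using (Filter.tendsto_id (x := nhds (0 : ℝ))).const_mul 2
    · rintro s t ⟨_, h, hh, rfl⟩
      have h1 := norm_green_sub_le hl (integrable_indicator_L1 h) t s
      rw [integral_norm_indicator_L1] at h1
      rw [mem_closedBall_zero_iff] at hh
      rw [dist_eq_norm]
      refine h1.trans ?_
      rw [Subtype.dist_eq, Real.dist_eq]
      gcongr
      linarith

/-- The inclusion of the continuous functions on `[0, l]` into `L²[0, l]`. -/
def continuousToL2 (l : ℝ) (hl : 0 < l) : (Icc (0 : ℝ) l →ᵇ ℂ) →L[ℂ] EdgeL2 l :=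
  BoundedContinuousFunction.toLp 2 (edgeMeasure l) ℂ ∘L
    LinearMap.mkContinuous
      -- The extension beyond `[0, l]` by constants is invisible to `edgeMeasure l`.
      { toFun f := f.compContinuous ⟨projIcc 0 l hl.le, continuous_projIcc⟩
        map_add' _ _ := rfl
        map_smul' _ _ := rfl }
      1 fun f => by
        rw [one_mul]
        exact (BoundedContinuousFunction.norm_le (norm_nonneg _)).2
          fun t => BoundedContinuousFunction.norm_coe_le_norm f _

theorem coeFn_continuousToL2 {l : ℝ} (hl : 0 < l) (f : Icc (0 : ℝ) l →ᵇ ℂ) :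
    continuousToL2 l hl f =ᵐ[edgeMeasure l] fun t => f (projIcc 0 l hl.le t) :=
  BoundedContinuousFunction.coeFn_toLp 2 (edgeMeasure l) ℂ _

theorem coeFn_continuousToL2_greenOp {l : ℝ} (hl : 0 < l) (h : Lp ℂ 1 (edgeMeasure l)) :
    continuousToL2 l hl (greenOp l hl h) =ᵐ[edgeMeasure l]
      green l ((Icc 0 l).indicator h) := by
  filter_upwards [coeFn_continuousToL2 hl (greenOp l hl h), ae_restrict_mem measurableSet_Icc]
    with t ht hm
  rw [ht, greenOp_apply, projIcc_of_mem hl.le hm]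

/-- Multiplication by a function in `L²[0, l]`, as a map from `L²[0, l]` to `L¹[0, l]`. -/
def mulL2 {l : ℝ} (p : EdgeL2 l) : EdgeL2 l →L[ℂ] Lp ℂ 1 (edgeMeasure l) :=
  (ContinuousLinearMap.mul ℂ ℂ).holderL (edgeMeasure l) 2 2 1 p

theorem coeFn_mulL2 {l : ℝ} (p u : EdgeL2 l) :
    mulL2 p u =ᵐ[edgeMeasure l] fun t => p t * u t :=
  (ContinuousLinearMap.mul ℂ ℂ).coeFn_holder (r := 1) p u

/-! ### The Fredholm alternative for the Dirichlet operator -/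

/-- If `u` is the Green operator applied to `h = (z - V) u + y`, then `u` lies in the domain of
the Dirichlet operator and `D u = z u + y`. -/
theorem mem_dirichletGraph_of_eq_green {l : ℝ} (hl : 0 < l) {V : ℝ → ℝ}
    (hV : MemLp V 2 (edgeMeasure l)) (z : ℂ) {u y : EdgeL2 l} {h : Lp ℂ 1 (edgeMeasure l)}
    (hu : u = continuousToL2 l hl (greenOp l hl h))
    (hh : h =ᵐ[edgeMeasure l] fun t => (z - V t) * u t + y t) :
    (u, z • u + y) ∈ dirichletGraph l V := by
  have hint := integrable_indicator_L1 h
  have huf : u =ᵐ[edgeMeasure l] green l ((Icc 0 l).indicator h) := by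
    rw [hu]
    exact coeFn_continuousToL2_greenOp hl h
  have hVc : MemLp (fun t => (V t : ℂ)) 2 (edgeMeasure l) := hV.ofReal
  -- `V u` is in `L²`, not merely `L¹`, because `u` agrees almost everywhere with a bounded function
  -- in the range of the Green operator.
  have hVu : MemLp (fun t => (V t : ℂ) * u t) 2 (edgeMeasure l) := by
    refine MemLp.of_le_mul (c := 2 * l * ‖h‖) hVc
      (hVc.1.mul (Lp.aestronglyMeasurable u)) ?_
    filter_upwards [huf, ae_restrict_mem measurableSet_Icc] with t ht hm
    have := norm_green_le hl hint hm
    rw [integral_norm_indicator_L1] at this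
    rw [norm_mul, ht, mul_comm]
    gcongr
  have hL2 : MemLp (fun t => (V t : ℂ) * u t - z * u t - y t) 2 (edgeMeasure l) :=
    (hVu.sub ((Lp.memLp u).const_mul z)).sub (Lp.memLp y)
  refine ⟨_, _, ⟨_, isH2_green hint ?_ hL2, huf, ?_⟩, green_zero _ _, green_self hl _⟩
  · filter_upwards [hh, ae_restrict_mem measurableSet_Icc] with t ht hm
    rw [indicator_of_mem hm, ht]
    ring
  · filter_upwards [Lp.coeFn_add (z • u) y, Lp.coeFn_smul z u, huf] with t h1 h2 h3
    rw [h1, Pi.add_apply, h2, Pi.smul_apply, smul_eq_mul, ← h3]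
    ring

theorem dirichletOp_eq {l : ℝ} (hl : 0 < l) {V : ℝ → ℝ} {u v : EdgeL2 l}
    (h : (u, v) ∈ dirichletGraph l V) :
    ∃ hu : u ∈ (dirichletOp l V).domain, dirichletOp l V ⟨u, hu⟩ = v := by
  rw [← dirichletOp_graph hl, LinearPMap.mem_graph_iff] at h
  obtain ⟨x, rfl, hx⟩ := h
  exact ⟨x.2, hx⟩

/-- Every point of the spectrum of the Dirichlet operator is an eigenvalue. -/
theorem exists_dirichlet_eigenvector {l : ℝ} (hl : 0 < l) {V : ℝ → ℝ}
    (hV : MemLp V 2 (edgeMeasure l)) {z : ℂ} (hz : z ∈ spec (dirichletOp l V)) :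
    ∃ u : EdgeL2 l, u ≠ 0 ∧ (u, z • u) ∈ dirichletGraph l V := by
  by_contra! hno
  apply hz
  have hVc : MemLp (fun t => (V t : ℂ)) 2 (edgeMeasure l) := hV.ofReal
  have hp : MemLp (fun t => z - (V t : ℂ)) 2 (edgeMeasure l) := (memLp_const z).sub hVc
  let p : EdgeL2 l := hp.toLp
  -- Multiplication by the constant 1 serves as the inclusion of `L²` into `L¹`.
  let one : EdgeL2 l := (memLp_const (1 : ℂ)).toLp
  let G : Lp ℂ 1 (edgeMeasure l) →L[ℂ] EdgeL2 l := continuousToL2 l hl ∘L greenOp l hl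
  let K : EdgeL2 l →L[ℂ] EdgeL2 l := G ∘L mulL2 p
  have hmul : ∀ u : EdgeL2 l, mulL2 p u =ᵐ[edgeMeasure l] fun t => (z - V t) * u t := by
    intro u
    filter_upwards [coeFn_mulL2 p u, hp.coeFn_toLp] with t h1 h2
    rw [h1, h2]
  have hone : ∀ y : EdgeL2 l, mulL2 one y =ᵐ[edgeMeasure l] y := by
    intro y
    filter_upwards [coeFn_mulL2 one y,
      (memLp_const (p := 2) (μ := edgeMeasure l) (1 : ℂ)).coeFn_toLp] with t h1 h2
    rw [h1, h2, one_mul]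
  have hK : IsCompactOperator K :=
    ((isCompactOperator_greenOp hl).clm_comp (continuousToL2 l hl)).comp_clm (mulL2 p)
  rcases hK.hasEigenvalue_or_mem_resolventSet (one_ne_zero (α := ℂ)) with hev | hres
  · obtain ⟨u, hu, hu0⟩ := hev.exists_hasEigenvector
    have hKu : K u = u := by simpa using Module.End.mem_eigenspace_iff.1 hu
    refine absurd ?_ (hno u hu0)
    have := mem_dirichletGraph_of_eq_green hl hV z (u := u) (y := 0) (h := mulL2 p u) hKu.symm ?_
    · simpa using this
    · filter_upwards [hmul u, Lp.coeFn_zero ℂ 2 (edgeMeasure l)] with t h1 h2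
      rw [h1, h2]
      simp
  · have hunit : IsUnit (1 - K) := by simpa [spectrum.mem_resolventSet_iff] using hres
    -- A right inverse suffices: it gives solvability of `(D - z) u = y`, while uniqueness comes
    -- from the absence of eigenvectors.
    obtain ⟨B, hB⟩ := hunit.exists_right_inv
    have hgraph : ∀ y, (B (G (mulL2 one y)), z • B (G (mulL2 one y)) + y) ∈
        dirichletGraph l V := by
      intro y
      set u := B (G (mulL2 one y)) with hu
      have h1 : u - K u = G (mulL2 one y) := DFunLike.congr_fun hB (G (mulL2 one y))
      refine mem_dirichletGraph_of_eq_green hl hV z (h := mulL2 p u + mulL2 one y) ?_ ?_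
      · rw [map_add, map_add, ← sub_eq_iff_eq_add']
        exact h1
      · filter_upwards [hmul u, hone y, Lp.coeFn_add (mulL2 p u) (mulL2 one y)] with t a b c
        rw [c, Pi.add_apply, a, b]
    refine ⟨B ∘L G ∘L mulL2 one, fun y => ?_, fun x => ?_⟩
    · obtain ⟨h1, h2⟩ := dirichletOp_eq hl (hgraph y)
      refine ⟨h1, ?_⟩
      change dirichletOp l V ⟨B (G (mulL2 one y)), h1⟩ - z • B (G (mulL2 one y)) = y
      rw [h2, add_sub_cancel_left]
    · have hx : ((x : EdgeL2 l), dirichletOp l V x) ∈ dirichletGraph l V := by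
        rw [← dirichletOp_graph hl]
        exact LinearPMap.mem_graph _ x
      -- The difference of `R ((D - z) x)` and `x` is annihilated by `D - z`, so a nonzero
      -- difference would be an eigenvector.
      by_contra hne
      refine hno _ (sub_ne_zero.2 hne) ?_
      have := Submodule.sub_mem _ (hgraph (dirichletOp l V x - z • (x : EdgeL2 l))) hx
      convert this using 1
      refine Prod.ext rfl ?_
      simp only [ContinuousLinearMap.comp_apply, Prod.snd_sub, smul_sub]
      abel

/-! ### Eigenfunctions of the lattice Hamiltonian vanishing at all nodes -/

/-- The lattice function equal to `c e • u` on the edge `e`. -/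
def latticeState {l : ℝ} (u : EdgeL2 l) : (Edge →₀ ℂ) →ₗ[ℂ] LatticeL2 l where
  toFun c := ⟨fun e => c e • u, by
    refine (memℓp_zero (c.support.finite_toSet.subset fun e he => ?_)).of_exponent_ge zero_le
    exact Finsupp.mem_support_iff.2 fun h0 => he (by simp [h0])⟩
  map_add' c d := lp.ext (funext fun e => add_smul (c e) (d e) u)
  map_smul' a c := lp.ext (funext fun e => mul_smul a (c e) u)

theorem latticeState_apply {l : ℝ} (u : EdgeL2 l) (c : Edge →₀ ℂ) (e : Edge) :
    latticeState u c e = c e • u := rfl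

theorem latticeState_injective {l : ℝ} {u : EdgeL2 l} (hu : u ≠ 0) :
    Function.Injective (latticeState u) := by
  intro c d h
  ext e
  have := congrArg (fun φ : LatticeL2 l => φ e) h
  exact smul_left_injective ℂ hu this

/-- The fluxes into the nodes of the lattice function with coefficients `c`, built from a
function on `[0, l]` whose derivative is `a` at `0` and `b` at `l`. -/
def nodeFlux (θ β : ℝ) (a b : ℂ) : (Edge →₀ ℂ) →ₗ[ℂ] (ℤ × ℤ → ℂ) where
  toFun c x := c (x.1, x.2, .right) * a + (β : ℂ) * (c (x.1, x.2, .up) * a)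
    - phase (-(x.2 * θ)) * (c (x.1 - 1, x.2, .right) * b)
    - (β : ℂ) * phase (x.1 * θ) * (c (x.1, x.2 - 1, .up) * b)
  map_add' c d := by
    funext x
    simp only [Finsupp.add_apply, Pi.add_apply]
    ring
  map_smul' r c := by
    funext x
    simp only [Finsupp.smul_apply, Pi.smul_apply, smul_eq_mul, RingHom.id_apply]
    ring

/-- As `f` vanishes at both ends, every value condition reads `0 = 0` and the `α` term drops out;
only the balance of derivatives is left. -/
theorem mem_latticeGraph_latticeState {l : ℝ} {V : ℝ → ℝ} {θ α β : ℝ} {u v : EdgeL2 l}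
    {f f' : ℝ → ℂ} (h : EdgeAction l V u v f f') (h0 : f 0 = 0) (hl : f l = 0)
    {c : Edge →₀ ℂ} (hc : nodeFlux θ β (f' 0) (f' l) c = 0) :
    (latticeState u c, latticeState v c) ∈ latticeGraph l V θ α β := by
  refine ⟨fun e => c e • f, fun e => c e • f', fun e => h.smul (c e), ?_, ?_, ?_, ?_⟩ <;>
    intro m n
  · simp [h0]
  · simp [h0, hl]
  · simp [h0, hl]
  · simpa [h0] using! congrFun hc (m, n)

theorem mem_eigenspace_of_mem_latticeGraph {l : ℝ} (hl : 0 < l) {V : ℝ → ℝ} {θ α β : ℝ}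
    {φ : LatticeL2 l} {z : ℂ} (h : (φ, z • φ) ∈ latticeGraph l V θ α β) :
    φ ∈ eigenspace (latticeOp l V θ α β) z := by
  rw [← latticeOp_graph hl, LinearPMap.mem_graph_iff] at h
  obtain ⟨x, rfl, hx⟩ := h
  refine ⟨x, ?_, rfl⟩
  change latticeOp l V θ α β x - z • (x : LatticeL2 l) = 0
  rw [hx, sub_self]

/-! ### Counting edges against nodes in a finite block -/

/-- The edges issuing from the nodes of a `k × 2` block. -/
def blockEdges (k : ℕ) : Set Edge :=
  {e | e.1 ∈ Finset.Ico (0 : ℤ) k ∧ e.2.1 ∈ Finset.Ico (0 : ℤ) 2}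

/-- The endpoints of the edges in `blockEdges k`. -/
def blockNodes (k : ℕ) : Finset (ℤ × ℤ) :=
  Finset.Ico (0 : ℤ) (k + 1) ×ˢ Finset.Ico (0 : ℤ) 3

/-- None of the four edges meeting at such a node belongs to the block, so finitely many flux
equations control all of them. -/
theorem nodeFlux_eq_zero_of_notMem (θ β : ℝ) (a b : ℂ) {k : ℕ} {c : Edge →₀ ℂ}
    (hc : c ∈ Finsupp.supported ℂ ℂ (blockEdges k)) {x : ℤ × ℤ} (hx : x ∉ blockNodes k) :
    nodeFlux θ β a b c x = 0 := by
  have hz : ∀ e : Edge, e ∉ blockEdges k → c e = 0 := fun e he =>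
    Finsupp.notMem_support_iff.1 fun hs => he (hc hs)
  simp only [blockNodes, Finset.mem_product, Finset.mem_Ico] at hx
  have key : ∀ m n d, ¬ (0 ≤ m ∧ m < (k : ℤ) ∧ 0 ≤ n ∧ n < 2) → c (m, n, d) = 0 := by
    intro m n d hmn
    apply hz
    simp only [blockEdges, mem_ofPred_eq, Finset.mem_Ico]
    tauto
  simp only [nodeFlux, LinearMap.coe_mk, AddHom.coe_mk]
  rw [key x.1 x.2 .right (by omega), key x.1 x.2 .up (by omega),
    key (x.1 - 1) x.2 .right (by omega), key x.1 (x.2 - 1) .up (by omega)]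
  simp

/-- `Dir` has two elements. -/
def dirEquivBool : Dir ≃ Bool where
  toFun
    | .right => true
    | .up => false
  invFun
    | true => .right
    | false => .up
  left_inv d := by cases d <;> rfl
  right_inv b := by cases b <;> rfl

/-- `blockEdges k` is a product of three finite sets. -/
def blockEdgesEquiv (k : ℕ) :
    (Finset.Ico (0 : ℤ) k × Finset.Ico (0 : ℤ) 2) × Bool ≃ blockEdges k where
  toFun x := ⟨(x.1.1, x.1.2, dirEquivBool.symm x.2), x.1.1.2, x.1.2.2⟩
  invFun e := ((⟨e.1.1, e.2.1⟩, ⟨e.1.2.1, e.2.2⟩), dirEquivBool e.1.2.2)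
  left_inv x := by simp
  right_inv e := by simp

instance (k : ℕ) : Fintype (blockEdges k) := Fintype.ofEquiv _ (blockEdgesEquiv k)

theorem card_blockEdges (k : ℕ) : Fintype.card (blockEdges k) = 4 * k := by
  rw [← Fintype.card_congr (blockEdgesEquiv k)]
  simp
  ring

theorem card_blockNodes (k : ℕ) : (blockNodes k).card = 3 * (k + 1) := by
  rw [blockNodes, Finset.card_product]
  simp
  omega

/-- There are more edges than nodes, so many linearly independent families of coefficients
have no flux at any node. -/
theorem exists_submodule_le_ker_nodeFlux (θ β : ℝ) (a b : ℂ) (d : ℕ) :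
    ∃ S : Submodule ℂ (Edge →₀ ℂ), S ≤ LinearMap.ker (nodeFlux θ β a b) ∧
      d < Module.finrank ℂ S := by
  -- Chosen so that `4 * k - 3 * (k + 1) = k - 3 = d + 1` exceeds `d`.
  let k := d + 4
  let P := Finsupp.supported ℂ ℂ (blockEdges k)
  let A : P →ₗ[ℂ] (blockNodes k → ℂ) :=
    LinearMap.funLeft ℂ ℂ (Subtype.val : blockNodes k → ℤ × ℤ) ∘ₗ nodeFlux θ β a b ∘ₗ P.subtype
  let eP : P ≃ₗ[ℂ] (blockEdges k →₀ ℂ) := Finsupp.supportedEquivFinsupp (blockEdges k)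
  have : FiniteDimensional ℂ P := eP.symm.finiteDimensional
  have hP : Module.finrank ℂ P = 4 * k := by
    rw [eP.finrank_eq, Module.finrank_finsupp_self, card_blockEdges]
  have hA := LinearMap.finrank_range_add_finrank_ker A
  have hr : Module.finrank ℂ (LinearMap.range A) ≤ 3 * (k + 1) := by
    refine (Submodule.finrank_le _).trans ?_
    rw [Module.finrank_fintype_fun_eq_card, Fintype.card_coe, card_blockNodes]
  refine ⟨(LinearMap.ker A).map P.subtype, ?_, ?_⟩
  · rintro _ ⟨c, hc, rfl⟩
    rw [LinearMap.mem_ker]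
    funext x
    by_cases hx : x ∈ blockNodes k
    · exact congrFun (LinearMap.mem_ker.1 hc) ⟨x, hx⟩
    · exact nodeFlux_eq_zero_of_notMem θ β a b c.2 hx
  · rw [LinearEquiv.finrank_eq (Submodule.equivMapOfInjective _ P.injective_subtype _).symm]
    omega

/-- A Dirichlet eigenvalue is an eigenvalue of infinite multiplicity of the lattice
Hamiltonian. -/
theorem not_finiteDimensional_eigenspace_latticeOp {l : ℝ} (hl : 0 < l) {V : ℝ → ℝ}
    (θ α β : ℝ) {u : EdgeL2 l} (hu : u ≠ 0) {z : ℂ} (hz : (u, z • u) ∈ dirichletGraph l V) :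
    ¬ FiniteDimensional ℂ (eigenspace (latticeOp l V θ α β) z) := by
  intro hfin
  obtain ⟨f, f', h, h0, h1⟩ := hz
  -- With `d` the supposed finite dimension of the eigenspace, `S` is too large to embed in it.
  obtain ⟨S, hS, hd⟩ := exists_submodule_le_ker_nodeFlux θ β (f' 0) (f' l)
    (Module.finrank ℂ (eigenspace (latticeOp l V θ α β) z))
  have hsmul : ∀ c, latticeState (z • u) c = z • latticeState u c := fun c =>
    lp.ext (funext fun e => smul_comm (c e) z u)
  have hmem : ∀ c : S, (latticeState u ∘ₗ S.subtype) c ∈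
      eigenspace (latticeOp l V θ α β) z := fun c =>
    mem_eigenspace_of_mem_latticeGraph hl
      (hsmul c ▸ mem_latticeGraph_latticeState h h0 h1 (LinearMap.mem_ker.1 (hS c.2)))
  have hinj : Function.Injective
      ((latticeState u ∘ₗ S.subtype).codRestrict _ hmem) := fun c d hcd =>
    (latticeState_injective hu).comp S.injective_subtype (congrArg Subtype.val hcd)
  exact absurd (LinearMap.finrank_le_finrank_of_injective hinj) hd.not_ge

/-- An eigenvalue belongs to the spectrum. -/
theorem IsEigenvalue.mem_spec {E : Type*} [NormedAddCommGroup E] [NormedSpace ℂ E]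
    {T : E →ₗ.[ℂ] E} {z : ℂ} (h : IsEigenvalue T z) : z ∈ spec T := by
  rintro ⟨R, -, hR⟩
  obtain ⟨_, ⟨x, hx, rfl⟩, hne⟩ := Submodule.exists_mem_ne_zero_of_ne_bot h
  have hx' : T x - z • (x : E) = 0 := hx
  have := hR x
  rw [hx', map_zero] at this
  exact hne this.symm

theorem isInfinitelyDegenerateEigenvalue_latticeOp {l : ℝ} (hl : 0 < l) {V : ℝ → ℝ}
    (hV : MemLp V 2 (edgeMeasure l)) (θ α β : ℝ) {z : ℂ} (hz : z ∈ spec (dirichletOp l V)) :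
    IsInfinitelyDegenerateEigenvalue (latticeOp l V θ α β) z := by
  obtain ⟨u, hu, hg⟩ := exists_dirichlet_eigenvector hl hV hz
  have h := not_finiteDimensional_eigenspace_latticeOp hl θ α β hu hg
  refine ⟨fun hbot => h ?_, h⟩
  rw [hbot]
  infer_instance

end

end MagneticLattice

theorem mainTheorem4 (l : ℝ) (hl : 0 < l) (V : ℝ → ℝ)
    (hV : MeasureTheory.MemLp V 2 (MagneticLattice.edgeMeasure l))
    (θ α β : ℝ) (hβ : β ≠ 0) :
    MagneticLattice.spec (MagneticLattice.dirichletOp l V) ⊆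
        MagneticLattice.spec (MagneticLattice.latticeOp l V θ α β) ∧
      ∀ μ ∈ MagneticLattice.spec (MagneticLattice.dirichletOp l V),
        MagneticLattice.IsInfinitelyDegenerateEigenvalue
          (MagneticLattice.latticeOp l V θ α β) μ := by
  have h := fun μ (hμ : μ ∈ MagneticLattice.spec (MagneticLattice.dirichletOp l V)) =>
    MagneticLattice.isInfinitelyDegenerateEigenvalue_latticeOp hl hV θ α β hμ
  exact ⟨fun μ hμ => (h μ hμ).1.mem_spec, h⟩
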